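/- Let $G=(V,E)$ be a finite simple graph, with one qubit for each vertex, and let $|G\rangle$ be its graph state, i.e. the (up to a phase unique) unit vector with $g_i|G\rangle=|G\rangle$ for all $i\in V$, where $g_i=X_i\prod_{j\in\mathcal N_i}Z_j$ and $\mathcal N_i$ is the neighbourhood of $i$. Let $A,B,C\in V$ be three mutually adjacent vertices. For every permutation $X,Y,Z$ of $A,B,C$ put $$T_{ABC}=\mathcal N_A\cap\mathcal N_B\cap\mathcal N_C,\qquad J_{XY}=(\mathcal N_X\cap\mathcal N_Y)\setminus(T_{ABC}\cup\{A,B,C\}),\qquad E_X=\mathcal N_X\setminus(\mathcal N_Y\cup\mathcal N_Z).$$ Suppose that for some permutation $X,Y,Z$ of $A,B,C$ at least one of the following holds: (1) $J_{XY}=J_{XZ}=\emptyset$; (2) $E_X=E_Y=\emptyset$; (3) $E_X=J_{XY}=\emptyset$. Then $|G\rangle$ cannot originate from any network with only bipartite sources. That is: for every network whose parties are the vertices in $V$ and which has finitely many sources, each connected to exactly two parties, the state $|G\rangle\langle G|$ cannot be written in the form $$\sum_\lambda p_\lambda\Big(\bigotimes_{v\in V}\mathcal E_v^{(\lambda)}\Big)\Big[\bigotimes_{s}\varrho_s\Big],$$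 where $s$ runs over the sources, $\varrho_s$ is a state of arbitrary finite local dimensions shared by the two parties connected to $s$, $\lambda$ is a discrete random variable with probabilities $p_\lambda$, and $\mathcal E_v^{(\lambda)}$ is a quantum channel (completely positive trace-preserving map) from all the systems received by the party $v$ to the qubit $v$. -/

import Mathlib

open scoped BigOperators Matrix ComplexOrder

namespace GraphNetwork

/-! ### Graph states -/

/-- The Pauli matrix `X`. -/
def pauliX : Matrix (Fin 2) (Fin 2) ℂ := !![0, 1; 1, 0]

/-- The Pauli matrix `Z`. -/
def pauliZ : Matrix (Fin 2) (Fin 2) ℂ := !![1, 0; 0, -1]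

section GraphState

variable {V : Type*} [Fintype V] [DecidableEq V]

/-- The tensor product `⨂ v, M v` of single-qubit operators, in the computational basis
`V → Fin 2` of the qubits labelled by `V`. -/
def qubitTensor (M : V → Matrix (Fin 2) (Fin 2) ℂ) : Matrix (V → Fin 2) (V → Fin 2) ℂ :=
  fun x y => ∏ v, M v (x v) (y v)

/-- The generator `g_i = X_i ∏_{j ∈ N(i)} Z_j`. -/
def generator (G : SimpleGraph V) [DecidableRel G.Adj] (i : V) :
    Matrix (V → Fin 2) (V → Fin 2) ℂ :=
  qubitTensor fun v => if v = i then pauliX else if G.Adj i v then pauliZ else 1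

/-- `ψ` is (a unit vector representing) the graph state of `G`: the common eigenvector with
eigenvalue `1` of all the generators. -/
def IsGraphState (G : SimpleGraph V) [DecidableRel G.Adj] (ψ : (V → Fin 2) → ℂ) : Prop :=
  star ψ ⬝ᵥ ψ = 1 ∧ ∀ i : V, generator G i *ᵥ ψ = ψ

end GraphState

/-- The rank-one operator `|ψ⟩⟨ψ|`. -/
def pureState {n : Type*} (ψ : n → ℂ) : Matrix n n ℂ := Matrix.vecMulVec ψ (star ψ)

/-! ### States, channels -/

/-- A density matrix: positive semidefinite of trace one. -/
def IsState {n : Type*} [Fintype n] (ρ : Matrix n n ℂ) : Prop :=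
  ρ.PosSemidef ∧ ρ.trace = 1

/-- The map `id_k ⊗ Φ`, which applies `Φ` to every block of a `k × k` block matrix. -/
def ampliation {m n : Type*} (Φ : Matrix m m ℂ →ₗ[ℂ] Matrix n n ℂ) (k : ℕ)
    (X : Matrix (Fin k × m) (Fin k × m) ℂ) : Matrix (Fin k × n) (Fin k × n) ℂ :=
  fun p q => Φ (Matrix.of fun a b => X (p.1, a) (q.1, b)) p.2 q.2

/-- A quantum channel: a completely positive and trace preserving linear map. -/
structure IsChannel {m n : Type*} [Fintype m] [Fintype n]
    (Φ : Matrix m m ℂ →ₗ[ℂ] Matrix n n ℂ) : Prop where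
  completelyPositive : ∀ (k : ℕ) (X : Matrix (Fin k × m) (Fin k × m) ℂ),
    X.PosSemidef → (ampliation Φ k X).PosSemidef
  tracePreserving : ∀ X : Matrix m m ℂ, (Φ X).trace = X.trace

/-- The tensor product `⨂ v, Φ v` of linear maps, applied to an operator `X` on the tensor
product of the spaces `ℂ^(m v)`: it is linear and maps the matrix unit
`|x⟩⟨y| = ⨂ v, |x v⟩⟨y v|` to `⨂ v, Φ v (|x v⟩⟨y v|)`. -/
noncomputable def tensorApply {V : Type*} [Fintype V] [DecidableEq V] {m n : V → Type*}
    [∀ v, Fintype (m v)] [∀ v, DecidableEq (m v)]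
    (Φ : ∀ v, Matrix (m v) (m v) ℂ →ₗ[ℂ] Matrix (n v) (n v) ℂ)
    (X : Matrix (∀ v, m v) (∀ v, m v) ℂ) : Matrix (∀ v, n v) (∀ v, n v) ℂ :=
  fun a b => ∑ x, ∑ y, X x y * ∏ v, Φ v (Matrix.single (x v) (y v) 1) (a v) (b v)

/-! ### Networks -/

/-- A network with set of parties `V`: finitely many sources, each of which distributes a
state among the parties in some finite set. -/
structure Network (V : Type*) where
  /-- the sources -/
  Source : Type
  [fintypeSource : Fintype Source]
  [decidableEqSource : DecidableEq Source]
  /-- the parties that receive a subsystem from the source -/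
  parties : Source → Finset V

attribute [instance] Network.fintypeSource Network.decidableEqSource

namespace Network

variable {V : Type*}

/-- All the sources of the network are bipartite. -/
def OnlyBipartite (N : Network V) : Prop := ∀ s, (N.parties s).card = 2

/-- Basis labels of the system emitted by the source `s`, where `d s v` is the dimension of
the subsystem that `s` sends to the party `v`. -/
abbrev Emitted (N : Network V) (d : N.Source → V → ℕ) (s : N.Source) : Type _ :=
  ∀ v : {v : V // v ∈ N.parties s}, Fin (d s v)

/-- Basis labels of the system received by the party `v`: one subsystem from each source
that is connected to `v`. -/
abbrev Received (N : Network V) (d : N.Source → V → ℕ) (v : V) : Type :=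
  ∀ s : {s : N.Source // v ∈ N.parties s}, Fin (d s v)

/-- The global source state `⨂ s, σ s`, with the subsystems regrouped by party. -/
noncomputable def sourceState (N : Network V) (d : N.Source → V → ℕ)
    (σ : ∀ s, Matrix (N.Emitted d s) (N.Emitted d s) ℂ) :
    Matrix (∀ v, N.Received d v) (∀ v, N.Received d v) ℂ :=
  fun x y => ∏ s, σ s (fun v => x v ⟨s, v.2⟩) (fun v => y v ⟨s, v.2⟩)

/-- The multi-qubit operator `ρ` (one qubit per party) can be prepared in the network `N` by
local operations and shared randomness:
`ρ = ∑_l p_l (⨂ v, Φ_v^(l)) [⨂ s, σ_s]`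
for a probability distribution `p` of the classical random variable `l`, for source states
`σ_s` of arbitrary finite local dimensions and for channels `Φ_v^(l)`. -/
def CanPrepare [Fintype V] [DecidableEq V] (N : Network V)
    (ρ : Matrix (V → Fin 2) (V → Fin 2) ℂ) : Prop :=
  ∃ (d : N.Source → V → ℕ) (σ : ∀ s, Matrix (N.Emitted d s) (N.Emitted d s) ℂ)
    (L : Type) (p : L → ℝ)
    (Φ : L → ∀ v, Matrix (N.Received d v) (N.Received d v) ℂ →ₗ[ℂ]
      Matrix (Fin 2) (Fin 2) ℂ),
    (∀ s, IsState (σ s)) ∧ (∀ l, 0 ≤ p l) ∧ HasSum p 1 ∧ (∀ l v, IsChannel (Φ l v)) ∧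
    HasSum (fun l => (p l : ℂ) • tensorApply (Φ l) (N.sourceState d σ)) ρ

end Network

/-! ### The neighbourhoods of a triangle -/

section Triangle

variable {V : Type*} (G : SimpleGraph V)

/-- The common part `T_XYZ = N_X ∩ N_Y ∩ N_Z`. -/
def commonPart (X Y Z : V) : Set V :=
  G.neighborSet X ∩ G.neighborSet Y ∩ G.neighborSet Z

/-- The pairwise part `J_XY` relative to the third vertex `Z` of the triangle: the vertices
outside the triangle that are neighbours of `X` and of `Y` but do not belong to `T_XYZ`. -/
def pairPart (X Y Z : V) : Set V :=
  ((G.neighborSet X ∩ G.neighborSet Y) \ commonPart G X Y Z) \ {X, Y, Z}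

/-- The exclusive part `E_X = N_X \ (N_Y ∪ N_Z)`. -/
def exclusivePart (X Y Z : V) : Set V :=
  G.neighborSet X \ (G.neighborSet Y ∪ G.neighborSet Z)

end Triangle

end GraphNetwork

/-!
A triangle `A`, `B`, `C` of a graph carries GHZ-type correlations, and these cannot be produced by
bipartite sources.

Each vertex `v` whose adjacencies to `A`, `B`, `C` are not all equal is attached to the vertex of
the triangle that is the odd one out. This gives three disjoint sets of vertices, containing `A`,
`B` and `C` respectively, and on each of them a Pauli string (`oddString`), with `Y` on the vertex
of the triangle and `Z` elsewhere. The product of the generators of two vertices of the triangle is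
the product of their two strings (`generator_mul_generator`), so any two strings are perfectly
correlated in the graph state, while each of them anticommutes with a generator and has mean
value `0` (`generator_mul_oddString`).

Suppose the graph state comes from a network with bipartite sources. As a pure state is extremal,
a single value of the shared randomness suffices (`mul_pureState_of_hasSum`). In the Heisenberg
picture the three strings become contractions `a`, `b`, `c` on the systems of the sources, and on
the purified source state `Ω = ⨂ s, Ω s` perfect correlation gives `a Ω = b Ω = c Ω`
(`mul_eq_mul_of_trace_eq_one`). A source reaches only two parties, so at least one of `a`, `b`, `c`
acts trivially on it; hence the common vector still has the factor `Ω s` at each source `s`, and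
it is a multiple of `Ω` (`mul_piTensor_comm_of_cross`). The multiple is the mean value of `a`, which
is `0`, but perfect correlation makes `a Ω` nonzero (`Network.trace_ne_zero_of_correlated`).

The argument applies to each triangle, whatever the remaining neighbourhoods of its vertices are.
-/

namespace GraphNetwork

set_option linter.unusedSectionVars false

/-! ### Tensor products of matrices -/

section PiTensor

variable {V : Type*} [Fintype V] [DecidableEq V] {m : V → Type*}

/-- The tensor product `⨂ v, M v` of square matrices, with rows and columns labelled by families
of labels; on qubits this is `qubitTensor`. -/
def piTensor (M : ∀ v, Matrix (m v) (m v) ℂ) : Matrix (∀ v, m v) (∀ v, m v) ℂ :=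
  fun x y => ∏ v, M v (x v) (y v)

lemma qubitTensor_eq_piTensor (M : V → Matrix (Fin 2) (Fin 2) ℂ) :
    qubitTensor M = piTensor M := rfl

lemma piTensor_conjTranspose (M : ∀ v, Matrix (m v) (m v) ℂ) :
    (piTensor M)ᴴ = piTensor fun v => (M v)ᴴ := by
  ext x y
  simp [piTensor, Matrix.conjTranspose_apply]

lemma piTensor_smul (c : V → ℂ) (M : ∀ v, Matrix (m v) (m v) ℂ) :
    piTensor (fun v => c v • M v) = (∏ v, c v) • piTensor M := by
  ext x y
  simp [piTensor, Finset.prod_mul_distrib]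

lemma piTensor_one [∀ v, DecidableEq (m v)] :
    piTensor (fun v => (1 : Matrix (m v) (m v) ℂ)) = 1 := by
  ext x y
  rw [Matrix.one_apply]
  split_ifs with h
  · subst h; simp [piTensor]
  · obtain ⟨v, hv⟩ := Function.ne_iff.mp h
    exact Finset.prod_eq_zero (Finset.mem_univ v) (Matrix.one_apply_ne hv)

variable [∀ v, Fintype (m v)]

lemma piTensor_mul (M N : ∀ v, Matrix (m v) (m v) ℂ) :
    piTensor M * piTensor N = piTensor fun v => M v * N v := by
  ext x y
  simp only [piTensor, Matrix.mul_apply, ← Finset.prod_mul_distrib]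
  rw [Finset.prod_univ_sum, Fintype.piFinset_univ]

variable [∀ v, DecidableEq (m v)]

lemma exists_eq_conjTranspose_mul_self {n : Type*} [Fintype n] {M : Matrix n n ℂ}
    (hM : M.PosSemidef) : ∃ B : Matrix n n ℂ, M = Bᴴ * B := by
  classical
  open scoped MatrixOrder in
  obtain ⟨B, hB⟩ := CStarAlgebra.nonneg_iff_eq_star_mul_self.mp hM.nonneg
  exact ⟨B, hB⟩

lemma piTensor_posSemidef {M : ∀ v, Matrix (m v) (m v) ℂ} (hM : ∀ v, (M v).PosSemidef) :
    (piTensor M).PosSemidef := by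
  choose B hB using fun v => exists_eq_conjTranspose_mul_self (hM v)
  have h : piTensor M = (piTensor B)ᴴ * piTensor B := by
    rw [piTensor_conjTranspose, piTensor_mul]
    exact congrArg piTensor (funext hB)
  rw [h]
  exact Matrix.posSemidef_conjTranspose_mul_self _

/-- The set of operators between `0` and `1` is closed under tensor products. -/
lemma one_sub_piTensor_posSemidef {M : ∀ v, Matrix (m v) (m v) ℂ}
    (h0 : ∀ v, (M v).PosSemidef) (h1 : ∀ v, (1 - M v).PosSemidef) :
    (1 - piTensor M).PosSemidef := by
  have key : ∀ F : Finset V,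
      (1 - piTensor (fun v => if v ∈ F then M v else 1)).PosSemidef := by
    intro F
    induction F using Finset.induction_on with
    | empty => simpa [piTensor_one] using Matrix.PosSemidef.zero
    | insert v F hv ih =>
      -- replacing the factor `1` by `M v` lowers the tensor product by a positive operator
      have hstep : piTensor (fun w => if w ∈ F then M w else 1) -
          piTensor (fun w => if w ∈ insert v F then M w else 1) =
          piTensor (fun w => if w = v then 1 - M w else if w ∈ F then M w else 1) := by
        ext x y
        simp only [piTensor, Matrix.sub_apply]
        rw [← Finset.mul_prod_erase _ _ (Finset.mem_univ v),
          ← Finset.mul_prod_erase _ (fun w => (if w ∈ insert v F then M w else 1) (x w) (y w))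
            (Finset.mem_univ v),
          ← Finset.mul_prod_erase _ (fun w => (if w = v then 1 - M w else
            if w ∈ F then M w else 1) (x w) (y w)) (Finset.mem_univ v)]
        have e1 : ∏ w ∈ Finset.univ.erase v,
            (if w ∈ insert v F then M w else 1) (x w) (y w) =
            ∏ w ∈ Finset.univ.erase v, (if w ∈ F then M w else 1) (x w) (y w) :=
          Finset.prod_congr rfl fun w hw => by
            simp [Finset.mem_insert, Finset.ne_of_mem_erase hw]
        have e2 : ∏ w ∈ Finset.univ.erase v,
            (if w = v then 1 - M w else if w ∈ F then M w else 1) (x w) (y w) =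
            ∏ w ∈ Finset.univ.erase v, (if w ∈ F then M w else 1) (x w) (y w) :=
          Finset.prod_congr rfl fun w hw => by
            simp [Finset.ne_of_mem_erase hw]
        rw [e1, e2]
        simp [hv, sub_mul]
      have hpos : (piTensor (fun w => if w = v then 1 - M w else
          if w ∈ F then M w else 1)).PosSemidef := by
        refine piTensor_posSemidef fun w => ?_
        split_ifs
        exacts [h1 w, h0 w, Matrix.PosSemidef.one]
      have := ih.add (hstep ▸ hpos)
      simpa using this
  simpa using key Finset.univ

lemma one_sub_mul_self_posSemidef {n : Type*} [Fintype n] [DecidableEq n] {D : Matrix n n ℂ}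
    (h0 : (1 - D).PosSemidef) (h1 : (1 + D).PosSemidef) : (1 - D * D).PosSemidef := by
  have e : 1 - D * D = (1 / 2 : ℂ) •
      ((1 - D)ᴴ * (1 + D) * (1 - D) + (1 + D)ᴴ * (1 - D) * (1 + D)) := by
    rw [h0.isHermitian.eq, h1.isHermitian.eq,
      show (1 - D) * (1 + D) * (1 - D) + (1 + D) * (1 - D) * (1 + D) = (2 : ℂ) • (1 - D * D) by
        rw [two_smul]; noncomm_ring]
    rw [smul_smul]; norm_num
  rw [e]
  exact ((h1.conjTranspose_mul_mul_same _).add (h0.conjTranspose_mul_mul_same _)).smul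
    (by norm_num [Complex.le_def])

/-- A tensor product of Hermitian contractions is a contraction. -/
lemma one_sub_piTensor_sq_posSemidef {D : ∀ v, Matrix (m v) (m v) ℂ}
    (h0 : ∀ v, (1 - D v).PosSemidef) (h1 : ∀ v, (1 + D v).PosSemidef) :
    (1 - (piTensor D)ᴴ * piTensor D).PosSemidef := by
  have hD : ∀ v, (D v)ᴴ = D v := fun v => by simpa using (h1 v).isHermitian.eq
  rw [piTensor_conjTranspose, piTensor_mul]
  refine one_sub_piTensor_posSemidef
    (fun v => Matrix.posSemidef_conjTranspose_mul_self _) fun v => ?_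
  rw [hD]
  exact one_sub_mul_self_posSemidef (h0 v) (h1 v)

end PiTensor

/-! ### Channels and their duals -/

section Channel

variable {m n : Type} [Fintype m] [DecidableEq m] [Fintype n]

/-- The Choi matrix of a completely positive map is positive, hence a sum of rank-one operators:
this is the Kraus decomposition, read off in coordinates. -/
lemma IsChannel.exists_kraus {Φ : Matrix m m ℂ →ₗ[ℂ] Matrix n n ℂ} (hΦ : IsChannel Φ) :
    ∃ (κ : Type) (_ : Fintype κ) (B : κ → m → n → ℂ), ∀ x y a b,
      Φ (Matrix.single x y 1) a b = ∑ k, star (B k x a) * B k y b := by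
  let e := Fintype.equivFin m
  let u : Fin (Fintype.card m) × m → ℂ := fun p => if p.1 = e p.2 then 1 else 0
  have h := hΦ.completelyPositive _ _ (Matrix.posSemidef_vecMulVec_self_star u)
  obtain ⟨B, hB⟩ := exists_eq_conjTranspose_mul_self h
  refine ⟨Fin (Fintype.card m) × n, inferInstance, fun k x a => B k (e x, a), fun x y a b => ?_⟩
  have h1 := congrFun (congrFun hB (e x, a)) (e y, b)
  rw [Matrix.mul_apply] at h1
  simp only [Matrix.conjTranspose_apply] at h1
  rw [← h1, ampliation]
  refine congrFun (congrFun (congrArg Φ ?_) a) b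
  ext x' y'
  simp only [Matrix.single, Matrix.of_apply, Matrix.vecMulVec_apply, u, Pi.star_apply,
    EmbeddingLike.apply_eq_iff_eq]
  split_ifs <;> simp_all

/-- The dual (Heisenberg picture) of a linear map `Φ` of operators, for the trace pairing:
`tr (M * Φ X) = tr (dualMap Φ M * X)`. -/
noncomputable def dualMap (Φ : Matrix m m ℂ →ₗ[ℂ] Matrix n n ℂ) (M : Matrix n n ℂ) :
    Matrix m m ℂ :=
  fun y x => (M * Φ (Matrix.single x y 1)).trace

lemma dualMap_add (Φ : Matrix m m ℂ →ₗ[ℂ] Matrix n n ℂ) (M N : Matrix n n ℂ) :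
    dualMap Φ (M + N) = dualMap Φ M + dualMap Φ N := by
  ext y x; simp [dualMap, add_mul]

lemma dualMap_sub (Φ : Matrix m m ℂ →ₗ[ℂ] Matrix n n ℂ) (M N : Matrix n n ℂ) :
    dualMap Φ (M - N) = dualMap Φ M - dualMap Φ N := by
  ext y x; simp [dualMap, sub_mul]

lemma IsChannel.dualMap_one [DecidableEq n] {Φ : Matrix m m ℂ →ₗ[ℂ] Matrix n n ℂ}
    (hΦ : IsChannel Φ) : dualMap Φ 1 = 1 := by
  ext y x
  rw [dualMap, one_mul, hΦ.tracePreserving, Matrix.one_apply]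
  split_ifs with h
  · subst h; simp
  · exact Matrix.trace_single_eq_of_ne x y (1 : ℂ) (Ne.symm h)

lemma IsChannel.dualMap_posSemidef {Φ : Matrix m m ℂ →ₗ[ℂ] Matrix n n ℂ}
    (hΦ : IsChannel Φ) {M : Matrix n n ℂ} (hM : M.PosSemidef) : (dualMap Φ M).PosSemidef := by
  obtain ⟨N, rfl⟩ := exists_eq_conjTranspose_mul_self hM
  obtain ⟨κ, _, B, hB⟩ := hΦ.exists_kraus
  let F : Matrix (n × κ) m ℂ := Matrix.of fun p x => ∑ j, N p.1 j * star (B p.2 x j)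
  have h : dualMap Φ (Nᴴ * N) = Fᴴ * F := by
    ext y x
    rw [dualMap, mul_assoc, Matrix.trace_mul_comm, Matrix.trace, Matrix.mul_apply,
      Fintype.sum_prod_type]
    refine Finset.sum_congr rfl fun c _ => ?_
    simp only [Matrix.diag_apply, Matrix.mul_apply, Matrix.conjTranspose_apply, hB, F,
      Matrix.of_apply, star_sum, star_mul', star_star, Finset.sum_mul, Finset.mul_sum]
    rw [Finset.sum_comm_cycle]
    refine Finset.sum_congr rfl fun k _ => Finset.sum_comm.trans ?_
    exact Finset.sum_congr rfl fun i _ => Finset.sum_congr rfl fun j _ => by ring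
  rw [h]
  exact Matrix.posSemidef_conjTranspose_mul_self _

end Channel

/-! ### Tensor products of channels -/

section TensorChannel

variable {V : Type*} [Fintype V] [DecidableEq V] {m n : V → Type}
  [∀ v, Fintype (m v)] [∀ v, DecidableEq (m v)] [∀ v, Fintype (n v)]
  {Φ : ∀ v, Matrix (m v) (m v) ℂ →ₗ[ℂ] Matrix (n v) (n v) ℂ}

lemma tensorApply_posSemidef (hΦ : ∀ v, IsChannel (Φ v))
    {X : Matrix (∀ v, m v) (∀ v, m v) ℂ} (hX : X.PosSemidef) :
    (tensorApply Φ X).PosSemidef := by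
  obtain ⟨R, rfl⟩ := exists_eq_conjTranspose_mul_self hX
  choose κ hκ B hB using fun v => (hΦ v).exists_kraus
  let W : Matrix ((∀ v, m v) × (∀ v, κ v)) (∀ v, n v) ℂ :=
    Matrix.of fun p a => ∑ x, R p.1 x * ∏ v, B v (p.2 v) (x v) (a v)
  have h : tensorApply Φ (Rᴴ * R) = Wᴴ * W := by
    ext a b
    have hprod : ∀ x y : ∀ v, m v,
        ∏ v, Φ v (Matrix.single (x v) (y v) 1) (a v) (b v) =
        ∑ k : ∀ v, κ v, (∏ v, star (B v (k v) (x v) (a v))) * ∏ v, B v (k v) (y v) (b v) := by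
      intro x y
      simp only [hB, ← Finset.prod_mul_distrib]
      rw [Finset.prod_univ_sum, Fintype.piFinset_univ]
    simp only [tensorApply, hprod, Matrix.mul_apply, Matrix.conjTranspose_apply, W,
      Matrix.of_apply, Fintype.sum_prod_type, star_sum, star_mul', star_prod, Finset.sum_mul,
      Finset.mul_sum]
    refine Finset.sum_comm_cycle.trans
      ((Finset.sum_congr rfl fun _ _ => Finset.sum_comm_cycle).trans (Finset.sum_comm.trans ?_))
    refine Finset.sum_congr rfl fun j _ => Finset.sum_congr rfl fun k _ =>
      Finset.sum_comm.trans ?_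
    exact Finset.sum_congr rfl fun y _ => Finset.sum_congr rfl fun x _ => by ring
  rw [h]
  exact Matrix.posSemidef_conjTranspose_mul_self _

/-- Duality between the Schrödinger and the Heisenberg picture for product observables. -/
lemma trace_piTensor_mul_tensorApply (M : ∀ v, Matrix (n v) (n v) ℂ)
    (X : Matrix (∀ v, m v) (∀ v, m v) ℂ) :
    (piTensor M * tensorApply Φ X).trace =
      (piTensor (fun v => dualMap (Φ v) (M v)) * X).trace := by
  have hprod : ∀ x y : ∀ v, m v,
      piTensor (fun v => dualMap (Φ v) (M v)) y x =
      ∑ b : ∀ v, n v, ∑ a : ∀ v, n v,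
        (∏ v, M v (b v) (a v)) * ∏ v, Φ v (Matrix.single (x v) (y v) 1) (a v) (b v) := by
    intro x y
    simp only [piTensor, dualMap, Matrix.trace, Matrix.diag_apply, Matrix.mul_apply,
      ← Finset.prod_mul_distrib]
    rw [Finset.prod_univ_sum, Fintype.piFinset_univ]
    refine Finset.sum_congr rfl fun b _ => ?_
    rw [Finset.prod_univ_sum, Fintype.piFinset_univ]
  rw [Matrix.trace, Matrix.trace]
  simp only [Matrix.diag_apply, Matrix.mul_apply, hprod]
  simp only [tensorApply, piTensor, Finset.sum_mul, Finset.mul_sum]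
  refine Finset.sum_comm_cycle.trans
    ((Finset.sum_congr rfl fun _ _ => Finset.sum_comm_cycle).trans (Finset.sum_comm.trans ?_))
  exact Finset.sum_congr rfl fun y _ => Finset.sum_congr rfl fun x _ =>
    Finset.sum_congr rfl fun b _ => Finset.sum_congr rfl fun a _ => by ring

end TensorChannel

/-! ### Product vectors -/

section ProductVector

variable {S : Type*} [Fintype S] [DecidableEq S] {α : S → Type*}

/-- The operator `A` on `⨂ s, ℂ^(α s)` acts as the identity on the tensor factor `s`, i.e. it has
the form `1_s ⊗ A'`. -/
def IsTrivialAt (A : Matrix (∀ s, α s) (∀ s, α s) ℂ) (s : S) : Prop :=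
  (∀ e e', e s ≠ e' s → A e e' = 0) ∧
    ∀ e e', e s = e' s → ∀ t, A (Function.update e s t) (Function.update e' s t) = A e e'

/-- If `A` acts as the identity on the factor `s`, then `A` applied to a product vector still has
the old factor at `s`; the rank-one condition `x ∝ R s ⊗ y` is expressed by cross-multiplication. -/
lemma IsTrivialAt.mul_piTensor_cross [∀ s, Fintype (α s)] [∀ s, DecidableEq (α s)]
    {A : Matrix (∀ s, α s) (∀ s, α s) ℂ} {s : S} (hA : IsTrivialAt A s)
    (R : ∀ s, Matrix (α s) (α s) ℂ) (e f : ∀ s, α s) (t u : α s) :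
    (A * piTensor R) e f * R s t u =
      (A * piTensor R) (Function.update e s t) (Function.update f s u) * R s (e s) (f s) := by
  obtain ⟨h0, h1⟩ := hA
  have hfilter : ∀ e f : ∀ s, α s, (A * piTensor R) e f =
      ∑ e' ∈ Finset.univ.filter (fun e' => e' s = e s), A e e' * piTensor R e' f := by
    intro e f
    rw [Matrix.mul_apply]
    refine (Finset.sum_filter_of_ne fun e' _ hne => ?_).symm
    by_contra hs
    exact hne (by rw [h0 e e' (Ne.symm hs), zero_mul])
  rw [hfilter, hfilter, Finset.sum_mul, Finset.sum_mul]
  refine Finset.sum_bij' (fun e' _ => Function.update e' s t)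
    (fun e' _ => Function.update e' s (e s)) ?_ ?_ ?_ ?_ ?_
  · simp
  · simp
  · intro e' he'
    simp [← (Finset.mem_filter.mp he').2]
  · intro e' he'
    have := (Finset.mem_filter.mp he').2
    simp only [Function.update_self] at this
    simp [← this]
  · intro e' he'
    have hs := (Finset.mem_filter.mp he').2
    rw [h1 e e' hs.symm t]
    have hprod : ∏ w ∈ Finset.univ.erase s,
        R w (Function.update e' s t w) (Function.update f s u w) =
        ∏ w ∈ Finset.univ.erase s, R w (e' w) (f w) :=
      Finset.prod_congr rfl fun w hw => by
        simp [Function.update_of_ne (Finset.ne_of_mem_erase hw)]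
    simp only [piTensor]
    rw [← Finset.mul_prod_erase _ _ (Finset.mem_univ s),
      ← Finset.mul_prod_erase _ (fun w => R w (Function.update e' s t w)
        (Function.update f s u w)) (Finset.mem_univ s), hprod]
    simp only [Function.update_self, hs]
    ring

/-- A vector which has the factor `R s` at every site `s` is a multiple of the product vector
`⨂ s, R s`. -/
lemma mul_piTensor_comm_of_cross {R : ∀ s, Matrix (α s) (α s) ℂ}
    {Y : Matrix (∀ s, α s) (∀ s, α s) ℂ}
    (hY : ∀ s e f t u, Y e f * R s t u =
      Y (Function.update e s t) (Function.update f s u) * R s (e s) (f s))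
    (e f t u : ∀ s, α s) : Y e f * piTensor R t u = Y t u * piTensor R e f := by
  -- exchange the coordinates of `(e, f)` for those of `(t, u)` one at a time
  have key : ∀ F : Finset S, Y e f * ∏ s ∈ F, R s (t s) (u s) =
      Y (F.piecewise t e) (F.piecewise u f) * ∏ s ∈ F, R s (e s) (f s) := by
    intro F
    induction F using Finset.induction_on with
    | empty => simp
    | insert s F hs ih =>
      rw [Finset.prod_insert hs, Finset.prod_insert hs, Finset.piecewise_insert,
        Finset.piecewise_insert]
      have h := hY s (F.piecewise t e) (F.piecewise u f) (t s) (u s)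
      rw [Finset.piecewise_eq_of_notMem _ _ _ hs, Finset.piecewise_eq_of_notMem _ _ _ hs] at h
      linear_combination R s (t s) (u s) * ih + (∏ s ∈ F, R s (e s) (f s)) * h
  simpa [piTensor] using key Finset.univ

end ProductVector

/-! ### Perfectly correlated contractions -/

section Contractions

variable {n k : Type*} [Fintype n] [DecidableEq n] [Fintype k]

/-- Two contractions `a`, `b` whose correlation on the unit vector `Ω` is `1` agree on `Ω`. The
vector is written as a matrix, with the Hilbert–Schmidt inner product. -/
lemma mul_eq_mul_of_trace_eq_one {a b : Matrix n n ℂ} {Ω : Matrix n k ℂ}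
    (ha : (1 - aᴴ * a).PosSemidef) (hb : (1 - bᴴ * b).PosSemidef)
    (hΩ : (Ωᴴ * Ω).trace = 1) (hab : ((a * Ω)ᴴ * (b * Ω)).trace = 1) : a * Ω = b * Ω := by
  have hnorm : ∀ {c : Matrix n n ℂ}, (1 - cᴴ * c).PosSemidef →
      ((c * Ω)ᴴ * (c * Ω)).trace ≤ 1 := by
    intro c hc
    have h := (hc.conjTranspose_mul_mul_same Ω).trace_nonneg
    rw [Matrix.mul_sub, Matrix.sub_mul, Matrix.trace_sub, Matrix.mul_one, hΩ, sub_nonneg] at h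
    rw [Matrix.conjTranspose_mul]
    simpa only [Matrix.mul_assoc] using h
  have hba : ((b * Ω)ᴴ * (a * Ω)).trace = 1 := by
    rw [← Matrix.conjTranspose_conjTranspose (a * Ω), ← Matrix.conjTranspose_mul,
      Matrix.trace_conjTranspose, hab, star_one]
  have hle : ((a * Ω - b * Ω)ᴴ * (a * Ω - b * Ω)).trace ≤ 0 := by
    have e : ((a * Ω - b * Ω)ᴴ * (a * Ω - b * Ω)).trace =
        (((a * Ω)ᴴ * (a * Ω)).trace - 1) + (((b * Ω)ᴴ * (b * Ω)).trace - 1) := by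
      rw [Matrix.conjTranspose_sub, Matrix.sub_mul, Matrix.mul_sub, Matrix.mul_sub]
      simp only [Matrix.trace_sub, hab, hba]
      ring
    rw [e]
    exact add_nonpos (sub_nonpos.mpr (hnorm ha)) (sub_nonpos.mpr (hnorm hb))
  have hz := le_antisymm hle (Matrix.posSemidef_conjTranspose_mul_self _).trace_nonneg
  exact sub_eq_zero.mp (Matrix.trace_conjTranspose_mul_self_eq_zero_iff.mp hz)

end Contractions

section Triple

variable {S : Type*} [Fintype S] [DecidableEq S] {α : S → Type*}
  [∀ s, Fintype (α s)] [∀ s, DecidableEq (α s)]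

/-- Three contractions that are perfectly correlated on a product vector `⨂ s, R s`, and of which
at least one is trivial on each factor, map the product vector to a multiple of itself; in
particular they do not have mean value zero. -/
lemma trace_ne_zero_of_correlated {R : ∀ s, Matrix (α s) (α s) ℂ}
    (hR : ((piTensor R)ᴴ * piTensor R).trace = 1)
    {a b c : Matrix (∀ s, α s) (∀ s, α s) ℂ}
    (ha : (1 - aᴴ * a).PosSemidef) (hb : (1 - bᴴ * b).PosSemidef)
    (hc : (1 - cᴴ * c).PosSemidef)
    (hab : ((a * piTensor R)ᴴ * (b * piTensor R)).trace = 1)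
    (hbc : ((b * piTensor R)ᴴ * (c * piTensor R)).trace = 1)
    (hs : ∀ s, IsTrivialAt a s ∨ IsTrivialAt b s ∨ IsTrivialAt c s) :
    ((piTensor R)ᴴ * (a * piTensor R)).trace ≠ 0 := by
  intro h0
  have eab := mul_eq_mul_of_trace_eq_one ha hb hR hab
  have ebc := mul_eq_mul_of_trace_eq_one hb hc hR hbc
  have hcross := mul_piTensor_comm_of_cross (R := R) (Y := a * piTensor R) fun s e f t u => by
    rcases hs s with h | h | h
    · exact h.mul_piTensor_cross R e f t u
    · rw [eab]; exact h.mul_piTensor_cross R e f t u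
    · rw [eab, ebc]; exact h.mul_piTensor_cross R e f t u
  have hzero : a * piTensor R = 0 := by
    ext e f
    have h1 : (a * piTensor R) e f * ((piTensor R)ᴴ * piTensor R).trace =
        ((piTensor R)ᴴ * (a * piTensor R)).trace * piTensor R e f := by
      simp only [Matrix.trace, Matrix.diag_apply, Matrix.mul_apply (M := (piTensor R)ᴴ),
        Finset.mul_sum, Finset.sum_mul, Matrix.conjTranspose_apply]
      refine Finset.sum_congr rfl fun u _ => Finset.sum_congr rfl fun t _ => ?_
      linear_combination star (piTensor R t u) * hcross e f t u
    simpa [hR, h0] using h1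
  rw [hzero] at hab
  simp at hab

end Triple

/-! ### Network states -/

section NetworkStates

variable {V : Type*} [Fintype V] [DecidableEq V] (N : Network V) (d : N.Source → V → ℕ)

/-- Regrouping of the labels of all emitted subsystems: from "by source" to "by party". -/
def Network.regroup : (∀ s, N.Emitted d s) ≃ (∀ v, N.Received d v) where
  toFun e v s := e s ⟨v, s.2⟩
  invFun x s v := x v ⟨s, v.2⟩
  left_inv _ := rfl
  right_inv _ := rfl

lemma Network.sourceState_eq_submatrix (σ : ∀ s, Matrix (N.Emitted d s) (N.Emitted d s) ℂ) :
    N.sourceState d σ = (piTensor σ).submatrix (N.regroup d).symm (N.regroup d).symm := rfl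

variable {N d}

lemma Network.trace_mul_sourceState (A : Matrix (∀ v, N.Received d v) (∀ v, N.Received d v) ℂ)
    (σ : ∀ s, Matrix (N.Emitted d s) (N.Emitted d s) ℂ) :
    (A * N.sourceState d σ).trace =
      (A.submatrix (N.regroup d) (N.regroup d) * piTensor σ).trace := by
  have h : A = (A.submatrix (N.regroup d) (N.regroup d)).submatrix
      (N.regroup d).symm (N.regroup d).symm := by simp
  conv_lhs => rw [h, Network.sourceState_eq_submatrix, Matrix.submatrix_mul_equiv]
  exact (N.regroup d).symm.sum_comp
    fun e => (A.submatrix (N.regroup d) (N.regroup d) * piTensor σ) e e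

lemma trace_piTensor {S : Type*} [Fintype S] [DecidableEq S] {α : S → Type*}
    [∀ s, Fintype (α s)] (σ : ∀ s, Matrix (α s) (α s) ℂ) :
    (piTensor σ).trace = ∏ s, (σ s).trace := by
  simp only [Matrix.trace, Matrix.diag_apply, piTensor]
  rw [Finset.prod_univ_sum, Fintype.piFinset_univ]

/-- A product operator of the parties which is the identity at both ends of a source acts
trivially on that source. -/
lemma Network.isTrivialAt_piTensor
    {D : ∀ v, Matrix (N.Received d v) (N.Received d v) ℂ} {s : N.Source}
    (hD : ∀ v ∈ N.parties s, D v = 1) :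
    IsTrivialAt ((piTensor D).submatrix (N.regroup d) (N.regroup d)) s := by
  constructor
  · intro e e' hne
    obtain ⟨v, hv⟩ := Function.ne_iff.mp hne
    refine Finset.prod_eq_zero (Finset.mem_univ v.1) ?_
    rw [hD v.1 v.2]
    exact Matrix.one_apply_ne fun h => hv (congrFun h ⟨s, v.2⟩)
  · intro e e' he t
    refine Finset.prod_congr rfl fun v _ => ?_
    by_cases hv : v ∈ N.parties s
    · rw [hD v hv, Matrix.one_apply, Matrix.one_apply]
      congr 1
      refine propext ⟨fun h => funext fun u => ?_, fun h => funext fun u => ?_⟩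
      · have hu := congrFun h u
        by_cases hus : u.1 = s
        · obtain ⟨u, hu'⟩ := u
          subst hus
          exact congrFun he _
        · simpa [Network.regroup, Function.update_of_ne hus] using hu
      · have hu := congrFun h u
        by_cases hus : u.1 = s
        · obtain ⟨u, hu'⟩ := u
          subst hus
          simp [Network.regroup]
        · simpa [Network.regroup, Function.update_of_ne hus] using hu
    · have hupd : ∀ e : ∀ s, N.Emitted d s,
          N.regroup d (Function.update e s t) v = N.regroup d e v := by
        intro e
        funext u
        have hus : u.1 ≠ s := fun h => hv (h ▸ u.2)
        simp [Network.regroup, Function.update_of_ne hus]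
      rw [hupd, hupd]

/-- In a network with bipartite sources, three product observables with disjoint supports of which
the first and the second, and the second and the third, are perfectly correlated cannot be
unbiased. -/
theorem Network.trace_ne_zero_of_correlated (hN : N.OnlyBipartite)
    {σ : ∀ s, Matrix (N.Emitted d s) (N.Emitted d s) ℂ} (hσ : ∀ s, IsState (σ s))
    {Φ : ∀ v, Matrix (N.Received d v) (N.Received d v) ℂ →ₗ[ℂ] Matrix (Fin 2) (Fin 2) ℂ}
    (hΦ : ∀ v, IsChannel (Φ v)) {M₁ M₂ M₃ : V → Matrix (Fin 2) (Fin 2) ℂ}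
    (h₁ : ∀ v, (1 - M₁ v).PosSemidef ∧ (1 + M₁ v).PosSemidef)
    (h₂ : ∀ v, (1 - M₂ v).PosSemidef ∧ (1 + M₂ v).PosSemidef)
    (h₃ : ∀ v, (1 - M₃ v).PosSemidef ∧ (1 + M₃ v).PosSemidef)
    (h₁₂ : ∀ v, M₁ v = 1 ∨ M₂ v = 1) (h₂₃ : ∀ v, M₂ v = 1 ∨ M₃ v = 1)
    (h₁₃ : ∀ v, M₁ v = 1 ∨ M₃ v = 1)
    (t₁₂ : (qubitTensor (fun v => M₁ v * M₂ v) * tensorApply Φ (N.sourceState d σ)).trace = 1)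
    (t₂₃ : (qubitTensor (fun v => M₂ v * M₃ v) * tensorApply Φ (N.sourceState d σ)).trace = 1) :
    (qubitTensor M₁ * tensorApply Φ (N.sourceState d σ)).trace ≠ 0 := by
  choose B hB using fun s => exists_eq_conjTranspose_mul_self (hσ s).1
  let R := fun s => (B s)ᴴ
  have hσR : piTensor σ = piTensor R * (piTensor R)ᴴ := by
    rw [piTensor_conjTranspose, piTensor_mul]
    exact congrArg piTensor (funext fun s => by simp [R, hB s])
  -- the observables in the Heisenberg picture, as operators on the systems of the sources
  let obs (M : V → Matrix (Fin 2) (Fin 2) ℂ) : Matrix (∀ s, N.Emitted d s) (∀ s, N.Emitted d s) ℂ :=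
    (piTensor fun v => dualMap (Φ v) (M v)).submatrix (N.regroup d) (N.regroup d)
  have htrace : ∀ M : V → Matrix (Fin 2) (Fin 2) ℂ,
      (qubitTensor M * tensorApply Φ (N.sourceState d σ)).trace =
        ((piTensor R)ᴴ * (obs M * piTensor R)).trace := by
    intro M
    rw [qubitTensor_eq_piTensor, trace_piTensor_mul_tensorApply, N.trace_mul_sourceState, hσR,
      ← Matrix.mul_assoc, Matrix.trace_mul_comm]
  have hadd : ∀ {M : V → Matrix (Fin 2) (Fin 2) ℂ},
      (∀ v, (1 - M v).PosSemidef ∧ (1 + M v).PosSemidef) → ∀ v,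
      (1 - dualMap (Φ v) (M v)).PosSemidef ∧ (1 + dualMap (Φ v) (M v)).PosSemidef := by
    intro M hM v
    rw [← (hΦ v).dualMap_one, ← dualMap_sub, ← dualMap_add]
    exact ⟨(hΦ v).dualMap_posSemidef (hM v).1, (hΦ v).dualMap_posSemidef (hM v).2⟩
  have hcontr : ∀ {M : V → Matrix (Fin 2) (Fin 2) ℂ},
      (∀ v, (1 - M v).PosSemidef ∧ (1 + M v).PosSemidef) →
      (1 - (obs M)ᴴ * obs M).PosSemidef := by
    intro M hM
    have h := (one_sub_piTensor_sq_posSemidef (fun v => (hadd hM v).1)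
      (fun v => (hadd hM v).2)).submatrix (N.regroup d)
    rw [Matrix.submatrix_sub, Pi.sub_apply, Pi.sub_apply, Matrix.submatrix_one_equiv,
      ← Matrix.submatrix_mul_equiv _ _ _ (N.regroup d)] at h
    exact h
  have hmul : ∀ {M M' : V → Matrix (Fin 2) (Fin 2) ℂ},
      (∀ v, (1 - M v).PosSemidef ∧ (1 + M v).PosSemidef) → (∀ v, M v = 1 ∨ M' v = 1) →
      (obs M)ᴴ * obs M' = obs fun v => M v * M' v := by
    intro M M' hM h
    have hH : ∀ v, (dualMap (Φ v) (M v))ᴴ = dualMap (Φ v) (M v) := fun v => by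
      simpa using (hadd hM v).2.isHermitian.eq
    simp only [obs]
    rw [Matrix.conjTranspose_submatrix, Matrix.submatrix_mul_equiv, piTensor_conjTranspose,
      piTensor_mul]
    congr 2
    funext v
    rw [hH]
    rcases h v with h | h <;> simp [h, (hΦ v).dualMap_one]
  have hcorr : ∀ {M M' : V → Matrix (Fin 2) (Fin 2) ℂ},
      (∀ v, (1 - M v).PosSemidef ∧ (1 + M v).PosSemidef) → (∀ v, M v = 1 ∨ M' v = 1) →
      ((obs M * piTensor R)ᴴ * (obs M' * piTensor R)).trace =
        (qubitTensor (fun v => M v * M' v) * tensorApply Φ (N.sourceState d σ)).trace := by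
    intro M M' hM h
    rw [htrace, ← hmul hM h, Matrix.conjTranspose_mul]
    simp only [Matrix.mul_assoc]
  have htriv : ∀ {M : V → Matrix (Fin 2) (Fin 2) ℂ} {s : N.Source},
      (∀ v ∈ N.parties s, M v = 1) → IsTrivialAt (obs M) s := fun h =>
    Network.isTrivialAt_piTensor fun v hv => by rw [h v hv, (hΦ v).dualMap_one]
  rw [htrace]
  refine GraphNetwork.trace_ne_zero_of_correlated ?_ (hcontr h₁) (hcontr h₂) (hcontr h₃)
    ((hcorr h₁ h₁₂).trans t₁₂) ((hcorr h₂ h₂₃).trans t₂₃) fun s => ?_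
  · rw [Matrix.trace_mul_comm, ← hσR, trace_piTensor]
    exact Finset.prod_eq_one fun s _ => (hσ s).2
  · -- a source with two parties misses the support of one of the three observables
    by_contra! hcon
    obtain ⟨n₁, n₂, n₃⟩ := hcon
    obtain ⟨u, hu, hu1⟩ : ∃ v ∈ N.parties s, M₁ v ≠ 1 := by
      by_contra! h; exact n₁ (htriv h)
    obtain ⟨v, hv, hv1⟩ : ∃ v ∈ N.parties s, M₂ v ≠ 1 := by
      by_contra! h; exact n₂ (htriv h)
    obtain ⟨w, hw, hw1⟩ : ∃ v ∈ N.parties s, M₃ v ≠ 1 := by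
      by_contra! h; exact n₃ (htriv h)
    have : 2 < (N.parties s).card := by
      refine Finset.two_lt_card.mpr ⟨u, hu, v, hv, w, hw, ?_, ?_, ?_⟩
      · rintro rfl; exact (h₁₂ u).elim hu1 hv1
      · rintro rfl; exact (h₁₃ u).elim hu1 hw1
      · rintro rfl; exact (h₂₃ v).elim hv1 hw1
    exact absurd (hN s) (by omega)

end NetworkStates

/-! ### Extremality of pure states -/

section PureMixture

variable {n : Type*} [Fintype n] [DecidableEq n]

/-- A pure state is extremal: each component of positive weight of a mixture of positive operators
that equals `|ψ⟩⟨ψ|` is supported on `ψ`. -/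
lemma mul_pureState_of_hasSum {ψ : n → ℂ} (hψ : star ψ ⬝ᵥ ψ = 1) {L : Type*} {p : L → ℝ}
    {ρ : L → Matrix n n ℂ} (hp : ∀ l, 0 ≤ p l) (hρ : ∀ l, (ρ l).PosSemidef)
    (hsum : HasSum (fun l => (p l : ℂ) • ρ l) (pureState ψ)) {l : L} (hl : p l ≠ 0) :
    pureState ψ * ρ l = ρ l := by
  -- `Q` is the projection onto the orthogonal complement of `ψ`
  set Q : Matrix n n ℂ := 1 - pureState ψ with hQ
  have hP : pureState ψ * pureState ψ = pureState ψ := by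
    rw [pureState, Matrix.vecMulVec_mul_vecMulVec, hψ, one_smul]
  have hPH : (pureState ψ)ᴴ = pureState ψ :=
    (Matrix.posSemidef_vecMulVec_self_star ψ).isHermitian.eq
  have hQH : Qᴴ = Q := by rw [hQ, Matrix.conjTranspose_sub, hPH, Matrix.conjTranspose_one]
  have hQQ : Qᴴ * Q = Q := by
    rw [hQH, hQ, mul_sub, sub_mul, sub_mul, hP]; simp
  have hpos : ∀ l, 0 ≤ (Q * ρ l).trace := fun l => by
    rw [← hQQ, Matrix.mul_assoc, Matrix.trace_mul_comm, hQH]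
    simpa [hQH] using ((hρ l).conjTranspose_mul_mul_same Q).trace_nonneg
  have hcont : Continuous fun M : Matrix n n ℂ => ((Q * M).trace).re := by
    fun_prop
  have h := hsum.map (AddMonoidHom.mk' (fun M : Matrix n n ℂ => ((Q * M).trace).re)
    fun M M' => by simp [Matrix.mul_add]) hcont
  have hz : (Q * pureState ψ).trace = 0 := by rw [hQ, sub_mul, hP]; simp
  simp only [Function.comp_def, AddMonoidHom.mk'_apply, hz, Complex.zero_re, Matrix.mul_smul,
    Matrix.trace_smul, smul_eq_mul, Complex.re_ofReal_mul] at h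
  have h0 := (hasSum_zero_iff_of_nonneg fun l =>
    mul_nonneg (hp l) (Complex.le_def.mp (hpos l)).1).mp h
  have hre : ((Q * ρ l).trace).re = 0 := (mul_eq_zero.mp (congrFun h0 l)).resolve_left hl
  have htr : (Q * ρ l).trace = 0 :=
    Complex.ext hre (Complex.le_def.mp (hpos l)).2.symm
  obtain ⟨B, hB⟩ := exists_eq_conjTranspose_mul_self (hρ l)
  have hBQ : B * Q = 0 := by
    rw [← Matrix.trace_conjTranspose_mul_self_eq_zero_iff, Matrix.conjTranspose_mul,
      Matrix.mul_assoc, Matrix.trace_mul_comm, Matrix.mul_assoc, Matrix.mul_assoc, hQH]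
    have : Bᴴ * (B * (Q * Q)) = ρ l * Q := by
      rw [← Matrix.mul_assoc, ← hB]; congr 1; simpa [hQH] using hQQ
    rw [this, Matrix.trace_mul_comm, htr]
  have hQρ : Q * ρ l = 0 := by
    have := congrArg (fun X => Xᴴ * B) hBQ
    simpa [Matrix.conjTranspose_mul, hQH, Matrix.mul_assoc, ← hB] using this
  rw [hQ, sub_mul, one_mul, sub_eq_zero] at hQρ
  exact hQρ.symm

end PureMixture

/-! ### Pauli strings of a triangle -/

section Strings

variable {V : Type*} [Fintype V] [DecidableEq V] (G : SimpleGraph V) [DecidableRel G.Adj]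

/-- The Pauli matrix `Y`. -/
def pauliY : Matrix (Fin 2) (Fin 2) ℂ := !![0, -Complex.I; Complex.I, 0]

/-- For a triangle `X`, `Y`, `Z`, the Pauli string with `Y` on `X` and `Z` on all vertices
`v ≠ X` whose adjacency to `X` differs from the one to `Y` and to `Z`. The condition in the
definition holds for `v = X` and fails for `v = Y` and `v = Z`. -/
def oddString (X Y Z : V) (v : V) : Matrix (Fin 2) (Fin 2) ℂ :=
  if (G.Adj Y v ↔ G.Adj Z v) ∧ ¬(G.Adj X v ↔ G.Adj Y v) then
    if v = X then pauliY else pauliZ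
  else 1

variable {G}

lemma oddString_bounds (X Y Z v : V) :
    (1 - oddString G X Y Z v).PosSemidef ∧ (1 + oddString G X Y Z v).PosSemidef := by
  -- for a Hermitian involution `M`, the operators `1 ± M` are multiples of projections
  have key : ∀ M : Matrix (Fin 2) (Fin 2) ℂ, Mᴴ = M → M * M = 1 →
      (1 - M).PosSemidef ∧ (1 + M).PosSemidef := by
    intro M hM hMM
    have e1 : 1 - M = (1 / 2 : ℂ) • ((1 - M)ᴴ * (1 - M)) := by
      rw [Matrix.conjTranspose_sub, hM, Matrix.conjTranspose_one, mul_sub, sub_mul, sub_mul, hMM]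
      ext i j; simp; ring
    have e2 : 1 + M = (1 / 2 : ℂ) • ((1 + M)ᴴ * (1 + M)) := by
      rw [Matrix.conjTranspose_add, hM, Matrix.conjTranspose_one, mul_add, add_mul, add_mul, hMM]
      ext i j; simp; ring
    have hhalf : (0 : ℂ) ≤ 1 / 2 := by norm_num [Complex.le_def]
    constructor
    · rw [e1]; exact (Matrix.posSemidef_conjTranspose_mul_self _).smul hhalf
    · rw [e2]; exact (Matrix.posSemidef_conjTranspose_mul_self _).smul hhalf
  unfold oddString
  split_ifs
  · refine key _ ?_ ?_ <;> ext i j <;> fin_cases i <;> fin_cases j <;> simp [pauliY]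
  · refine key _ ?_ ?_ <;> ext i j <;> fin_cases i <;> fin_cases j <;> simp [pauliZ]
  · exact key _ (by simp) (by simp)

lemma oddString_disjoint (X Y Z v : V) :
    oddString G X Y Z v = 1 ∨ oddString G Y X Z v = 1 := by
  unfold oddString
  split_ifs <;> tauto

lemma oddString_swap (X Y Z v : V) : oddString G X Y Z v = oddString G X Z Y v := by
  have : ((G.Adj Y v ↔ G.Adj Z v) ∧ ¬(G.Adj X v ↔ G.Adj Y v)) ↔
      ((G.Adj Z v ↔ G.Adj Y v) ∧ ¬(G.Adj X v ↔ G.Adj Z v)) := by tauto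
  simp only [oddString, this]

lemma pauliX_mul_pauliZ : pauliX * pauliZ = (-Complex.I) • pauliY := by
  ext i j; fin_cases i <;> fin_cases j <;> simp [pauliX, pauliY, pauliZ]

lemma pauliZ_mul_pauliX : pauliZ * pauliX = Complex.I • pauliY := by
  ext i j; fin_cases i <;> fin_cases j <;> simp [pauliX, pauliY, pauliZ]

lemma pauliZ_mul_pauliZ : pauliZ * pauliZ = 1 := by
  ext i j; fin_cases i <;> fin_cases j <;> simp [pauliZ]

lemma pauliX_mul_pauliY : pauliX * pauliY = (-1 : ℂ) • (pauliY * pauliX) := by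
  ext i j; fin_cases i <;> fin_cases j <;> simp [pauliX, pauliY]

/-- Along an edge of a triangle, the product of the generators of the graph state splits into the
strings of the two end points: a vertex adjacent to exactly one of `X`, `Y` belongs to the string
of exactly one of them, as decided by its adjacency to `Z`. -/
lemma generator_mul_generator {X Y Z : V} (hXY : G.Adj X Y) (hYZ : G.Adj Y Z) (hXZ : G.Adj X Z) :
    generator G X * generator G Y =
      qubitTensor fun v => oddString G X Y Z v * oddString G Y X Z v := by
  have hne : X ≠ Y := hXY.ne
  -- the phases of `XZ = -iY` at `X` and of `ZX = iY` at `Y` cancel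
  let c : V → ℂ := fun v => (if v = X then -Complex.I else 1) * (if v = Y then Complex.I else 1)
  have hc : ∏ v, c v = 1 := by
    simp only [c, Finset.prod_mul_distrib, Finset.prod_ite_eq', Finset.mem_univ, if_true]
    simp
  rw [generator, generator, qubitTensor_eq_piTensor, qubitTensor_eq_piTensor, piTensor_mul,
    qubitTensor_eq_piTensor]
  conv_rhs => rw [← one_smul ℂ (piTensor _), ← hc, ← piTensor_smul]
  congr 1
  funext v
  by_cases hX : v = X
  · subst hX
    simp [c, oddString, hXY.symm, hXZ.symm, hne, pauliX_mul_pauliZ]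
  by_cases hY : v = Y
  · subst hY
    simp [c, oddString, hXY, hYZ.symm, hX, pauliZ_mul_pauliX]
  by_cases h1 : G.Adj X v <;> by_cases h2 : G.Adj Y v <;> by_cases h3 : G.Adj Z v <;>
    simp [c, oddString, hX, hY, h1, h2, h3, pauliZ_mul_pauliZ]

lemma generator_mul_oddString {X Y Z : V} (hXY : G.Adj X Y) (hXZ : G.Adj X Z) :
    generator G X * qubitTensor (oddString G X Y Z) =
      -(qubitTensor (oddString G X Y Z) * generator G X) := by
  let c : V → ℂ := fun v => if v = X then -1 else 1
  have hc : ∏ v, c v = -1 := by simp [c]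
  rw [generator, qubitTensor_eq_piTensor, qubitTensor_eq_piTensor, piTensor_mul, piTensor_mul,
    ← neg_one_smul ℂ (piTensor _), ← hc, ← piTensor_smul]
  congr 1
  funext v
  by_cases hX : v = X
  · subst hX
    simpa [c, oddString, hXY.symm, hXZ.symm] using pauliX_mul_pauliY
  · simp only [c, oddString, hX, if_false, one_smul]
    split_ifs <;> simp

end Strings

end GraphNetwork

theorem theorem3 {V : Type*} [Fintype V] [DecidableEq V]
    (G : SimpleGraph V) [DecidableRel G.Adj] (A B C : V)
    (hAB : G.Adj A B) (hBC : G.Adj B C) (hAC : G.Adj A C)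
    (hcond : ∃ X Y Z : V, [X, Y, Z].Perm [A, B, C] ∧
      ((GraphNetwork.pairPart G X Y Z = ∅ ∧ GraphNetwork.pairPart G X Z Y = ∅) ∨
       (GraphNetwork.exclusivePart G X Y Z = ∅ ∧ GraphNetwork.exclusivePart G Y X Z = ∅) ∨
       (GraphNetwork.exclusivePart G X Y Z = ∅ ∧ GraphNetwork.pairPart G X Y Z = ∅)))
    (ψ : (V → Fin 2) → ℂ) (hψ : GraphNetwork.IsGraphState G ψ) :
    ∀ N : GraphNetwork.Network V, N.OnlyBipartite →
      ¬ N.CanPrepare (GraphNetwork.pureState ψ) := by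
  open GraphNetwork in
  rintro N hN ⟨d, σ, L, p, Φ, hσ, hp, hp1, hΦ, hsum⟩
  obtain ⟨l, hl⟩ : ∃ l, p l ≠ 0 := by
    by_contra! h
    rw [funext h] at hp1
    exact zero_ne_one (hasSum_zero.unique hp1)
  have hσpos : (N.sourceState d σ).PosSemidef := by
    rw [N.sourceState_eq_submatrix]
    exact (piTensor_posSemidef fun s => (hσ s).1).submatrix _
  have hρpos : ∀ l, (tensorApply (Φ l) (N.sourceState d σ)).PosSemidef := fun l =>
    tensorApply_posSemidef (hΦ l) hσpos
  have hρ := mul_pureState_of_hasSum hψ.1 hp hρpos hsum hl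
  set ρ := tensorApply (Φ l) (N.sourceState d σ) with hρdef
  have hρ1 : ρ.trace = 1 := by
    have h := trace_piTensor_mul_tensorApply (Φ := Φ l) (fun _ => 1) (N.sourceState d σ)
    simp only [(hΦ l _).dualMap_one, piTensor_one] at h
    rw [← hρdef, one_mul, N.trace_mul_sourceState, Matrix.submatrix_one_equiv, one_mul,
      trace_piTensor] at h
    rw [h]
    exact Finset.prod_eq_one fun s _ => (hσ s).2
  have hg : ∀ i, generator G i * ρ = ρ := fun i => by
    rw [← hρ, ← Matrix.mul_assoc, pureState, Matrix.mul_vecMulVec, hψ.2 i]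
  have hgH : ∀ i, (generator G i)ᴴ = generator G i := fun i => by
    rw [generator, qubitTensor_eq_piTensor, piTensor_conjTranspose]
    congr 1
    funext v
    split_ifs <;> ext i j <;> fin_cases i <;> fin_cases j <;> simp [pauliX, pauliZ]
  have hg' : ∀ i, ρ * generator G i = ρ := fun i => by
    have h := congrArg Matrix.conjTranspose (hg i)
    rwa [Matrix.conjTranspose_mul, hgH, (hρpos l).isHermitian.eq] at h
  have hedge : ∀ {X Y Z : V}, G.Adj X Y → G.Adj Y Z → G.Adj X Z →
      (qubitTensor (fun v => oddString G X Y Z v * oddString G Y X Z v) * ρ).trace = 1 := by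
    intro X Y Z hXY hYZ hXZ
    rw [← generator_mul_generator hXY hYZ hXZ, Matrix.mul_assoc, hg, hg, hρ1]
  have hBCtrace := hedge hBC hAC.symm hAB.symm
  simp only [oddString_swap B C A, oddString_swap C B A] at hBCtrace
  refine N.trace_ne_zero_of_correlated hN hσ (hΦ l) (oddString_bounds A B C)
    (oddString_bounds B A C) (oddString_bounds C A B) (oddString_disjoint A B C)
    (fun v => ?_) (fun v => ?_) (hedge hAB hBC hAC) hBCtrace ?_
  · rw [oddString_swap B A C, oddString_swap C A B]; exact oddString_disjoint B C A v
  · rw [oddString_swap A B C]; exact oddString_disjoint A C B v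
  · -- the mean value vanishes because the string of `A` anticommutes with the generator at `A`
    have h := congrArg (fun M => (M * ρ).trace) (generator_mul_oddString hAB hAC)
    simp only [Matrix.mul_assoc, Matrix.neg_mul, Matrix.trace_neg, hg] at h
    rw [Matrix.trace_mul_comm, Matrix.mul_assoc, hg'] at h
    exact self_eq_neg.mp h
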